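/- In the game of cops versus the $1$-observed gambler on a finite connected graph $G$ with $k\ge 1$ cops, the gambler fixes a probability distribution $p$ on $V(G)$, unknown to the cops, and occupies on each of its turns a vertex drawn independently from $p$. One gambler turn $g_0$ is shown to the cops; afterwards the game is played in darkness. The cops have initial positions on vertices of $G$ (several cops may share a vertex). In each round $t=1,2,\dots$ every cop stays at its vertex or moves to an adjacent vertex, while simultaneously the gambler moves to a new random vertex $g_t$. The capture time is the first $t\ge 1$ such that after round $t$ some cop is at $g_t$ ($\infty$ if there is none). The cops may randomize. Let $\operatorname{ect}_{1,k}(G)$ be the infimum over all (randomized) strategies of the $k$ cops of the supremum over all distributions $p$ of the expected capture time, and let $$\operatorname{th}_1(G)=\min_{k\ge 1}\bigl(k+\operatorname{ect}_{1,k}(G)\bigr).$$ **Theorem.** There is an absolute constant $C$ such that for every $n$ and every connected graph $G$ of order $n$, $$\operatorname{th}_1(G)\le \frac{\sqrt{42}}{2}\sqrt{n}+C .$$ This holds both when the cops have to choose their initial positions before seeing $g_0$ and when they may choose them after seeing $g_0$. -/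

import Mathlib

open MeasureTheory
open scoped ENNReal

universe u

noncomputable section

namespace Gambler

/-- When the cops choose their initial positions: before or after seeing the observed gambler
turn. In the first case the initial positions cannot depend on the observation. -/
inductive Placement
  | beforeObservation
  | afterObservation

/-- A (pure) plan of `k` cops against the `1`-observed gambler: `s o t i` is the position of cop `i`
after round `t` (`t = 0` is the initial position) when the observed gambler turn was `o`.
The game is played in darkness, so the observation is all the information the cops ever get. -/
abbrev Plan (V : Type u) (k : ℕ) : Type u := V → ℕ → Fin k → V

/-- In each round every cop stays at its vertex or moves to a neighbouring vertex; several cops may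
share a vertex. Under `Placement.beforeObservation` the initial positions ignore the observation. -/
def Plan.IsLegal {V : Type u} {k : ℕ} (G : SimpleGraph V) (pl : Placement) (s : Plan V k) : Prop :=
  (∀ o t i, s o (t + 1) i = s o t i ∨ G.Adj (s o t i) (s o (t + 1) i)) ∧
  (pl = Placement.beforeObservation → ∀ o o', s o 0 = s o' 0)

/-- The law of the gambler's turns: independent vertices, each drawn from the fixed distribution
`p`. -/
def law {V : Type u} [MeasurableSpace V] (p : PMF V) : Measure (ℕ → V) :=
  Measure.infinitePi (fun _ : ℕ => p.toMeasure)

/-- The number of the first round `t ≥ 1` after which some cop is at the gambler's vertex, for cop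
positions `c` and gambler positions `g`; it is `∞` if there is no such round. -/
def captureTime {V : Type u} {k : ℕ} (c : ℕ → Fin k → V) (g : ℕ → V) : ℝ≥0∞ :=
  ⨅ t ∈ {t : ℕ | 1 ≤ t ∧ ∃ i, c t i = g t}, (t : ℝ≥0∞)

/-- The expected capture time of the randomized plan `μ` against the gambler with distribution `p`.
The turn `g 0` is the observed one, `g t` is the gambler's position in round `t ≥ 1`. -/
def expectedTime {V : Type u} [MeasurableSpace V] {k : ℕ} (μ : Measure (Plan V k)) (p : PMF V) :
    ℝ≥0∞ :=
  ∫⁻ s, ∫⁻ g, captureTime (s (g 0)) g ∂(law p) ∂μ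

/-- A randomized (mixed) strategy of the cops: a random legal plan. -/
def IsStrategy {V : Type u} [MeasurableSpace V] {k : ℕ} (G : SimpleGraph V) (pl : Placement)
    (μ : Measure (Plan V k)) : Prop :=
  IsProbabilityMeasure μ ∧ ∀ᵐ s ∂μ, s.IsLegal G pl

/-- The expected capture time of the `1`-observed gambler against `k` cops under optimal play: the
cops minimize, over their randomized strategies, the worst case over the gambler's distributions,
which the cops do not know. -/
def ect₁ {V : Type u} (G : SimpleGraph V) (pl : Placement) (k : ℕ) : ℝ≥0∞ :=
  letI : MeasurableSpace V := ⊤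
  ⨅ μ ∈ {μ : Measure (Plan V k) | IsStrategy G pl μ}, ⨆ p : PMF V, expectedTime μ p

/-- The throttling number for the `1`-observed gambler: the minimum of `k + ect₁` over all positive
integers `k`. -/
def th₁ {V : Type u} (G : SimpleGraph V) (pl : Placement) : ℝ≥0∞ :=
  ⨅ k ∈ {k : ℕ | 1 ≤ k}, ((k : ℝ≥0∞) + ect₁ G pl k)

end Gambler

end

/-!
The observed turn is not needed: a randomly started patrol already does better than required.

A connected graph of order `n` has a closed walk of length at most `2 (n - 1)` through all its
vertices; padded by waiting, it becomes a tour `W` of period `k L` with `L = 2 n / k + 1`. The `k`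
cops follow `W` at mutual distance `L`, so that together their positions have period `L` and cover
the graph in every period. They start at a uniformly random phase `θ < L`.

Fix the gambler's distribution and let `a j` be the probability that in round `j` he avoids all the
vertices that `W` visits at times congruent to `j` modulo `L`. His turns are independent, so he
survives rounds `θ + 1, …, θ + s` with probability `∏ a`, and the expected capture time is the sum
of these products over `s` (`lintegral_captureTime_patrol_le`). As the hazards `1 - a j` of a period
sum to at least `1`, the survival probability `q` of a period is at most `exp (-1) ≤ 13 / 29`
(`survival_avoidProb_le`). The process restarts after each period, which bounds the infinite sum by
that over one period divided by `1 - q` (`sum_survival_mul_le`). In the average over `θ`, surviving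
the first `r` rounds of a period pairs up with surviving the last `L - r`: the two probabilities
multiply to `q`, and both are at most `1`, so their sum is at most `1 + q`
(`sum_survival_add_le`). The expected capture time is therefore at most
`L (1 + q) / (2 (1 - q)) + 1 / 2 ≤ 21 / 16 * L + 1 / 2`, hence at most `21 / 8 * n / k + O(1)`, and
`k ≈ √(21 n / 8) = √42 / 4 * √n` balances the two terms of the throttling number.
-/

namespace Gambler

/-! ### A closed walk through all vertices -/

/-- A closed walk that misses some vertex can be extended by a detour along an edge leaving its
support, which adds two steps and a new vertex. -/
theorem exists_closed_walk_length_le {V : Type u} [Fintype V] [DecidableEq V]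
    {G : SimpleGraph V} (hG : G.Connected) (v : V) (m : ℕ) (hm : m + 1 ≤ Fintype.card V) :
    ∃ p : G.Walk v v, p.length ≤ 2 * m ∧ m + 1 ≤ p.support.toFinset.card := by
  induction m with
  | zero => exact ⟨.nil, by simp⟩
  | succ m ih =>
    obtain ⟨p, hp, hcard⟩ := ih (by omega)
    by_cases hall : ∀ w, w ∈ p.support
    · have : p.support.toFinset = Finset.univ := by ext w; simpa using hall w
      exact ⟨p, by omega, by rw [this, Finset.card_univ]; exact hm⟩
    · push Not at hall
      obtain ⟨w, hw⟩ := hall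
      obtain ⟨q⟩ := hG.preconnected v w
      obtain ⟨d, -, h₁, h₂⟩ := q.exists_boundary_dart {x | x ∈ p.support} p.start_mem_support hw
      refine ⟨(p.takeUntil _ h₁).append (.cons d.adj (.cons d.adj.symm (p.dropUntil _ h₁))), ?_, ?_⟩
      · have := congrArg SimpleGraph.Walk.length (p.take_spec h₁)
        simp only [SimpleGraph.Walk.length_append, SimpleGraph.Walk.length_cons] at this ⊢
        omega
      · have hsub : insert d.snd p.support.toFinset ⊆ ((p.takeUntil _ h₁).append
            (.cons d.adj (.cons d.adj.symm (p.dropUntil _ h₁)))).support.toFinset := by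
          intro x hx
          have hx' : x = d.snd ∨ x ∈ p.support := by simpa using hx
          rw [← p.take_spec h₁, SimpleGraph.Walk.mem_support_append_iff] at hx'
          simp only [List.mem_toFinset, SimpleGraph.Walk.mem_support_append_iff,
            SimpleGraph.Walk.support_cons, List.mem_cons]
          tauto
        refine le_trans ?_ (Finset.card_le_card hsub)
        rw [Finset.card_insert_of_notMem (by simpa using h₂)]
        omega

/-- A depth-first tour, padded by waiting at its base point to any period `M ≥ 2 |V|`. -/
theorem exists_periodic_tour {V : Type u} [Fintype V] {G : SimpleGraph V} (hG : G.Connected)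
    {M : ℕ} (hM : 2 * Fintype.card V ≤ M) :
    ∃ W : ℕ → V, (∀ j, W (j + 1) = W j ∨ G.Adj (W j) (W (j + 1))) ∧ Function.Periodic W M ∧
      Function.Surjective W := by
  classical
  obtain ⟨v⟩ := hG.nonempty
  have hpos : 0 < Fintype.card V := Fintype.card_pos_iff.2 ⟨v⟩
  obtain ⟨p, hp, hcard⟩ := exists_closed_walk_length_le hG v (Fintype.card V - 1) (by omega)
  have hall : ∀ w, w ∈ p.support := by
    have : p.support.toFinset = Finset.univ :=
      Finset.eq_univ_of_card _ (le_antisymm (Finset.card_le_univ _) (by omega))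
    intro w
    have hw : w ∈ p.support.toFinset := by rw [this]; exact Finset.mem_univ w
    simpa using hw
  have hlen : p.length < M := by omega
  refine ⟨fun j => p.getVert (j % M), fun j => ?_, fun j => by simp, fun w => ?_⟩
  · dsimp only
    have hlt : j % M < M := Nat.mod_lt _ (by omega)
    rcases Nat.lt_or_ge (j % M) p.length with h | h
    · have hs : (j + 1) % M = j % M + 1 := by
        rw [← Nat.mod_add_mod, Nat.mod_eq_of_lt (by omega)]
      rw [hs]
      exact Or.inr (p.adj_getVert_succ h)
    · left
      rw [p.getVert_of_length_le h]
      rcases Nat.lt_or_ge (j % M + 1) M with h' | h'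
      · rw [← Nat.mod_add_mod, Nat.mod_eq_of_lt h', p.getVert_of_length_le (by omega)]
      · rw [← Nat.mod_add_mod, show j % M + 1 = M by omega, Nat.mod_self, p.getVert_zero]
  · obtain ⟨j, hj, hjl⟩ := SimpleGraph.Walk.mem_support_iff_exists_getVert.1 (hall w)
    exact ⟨j, by simpa [Nat.mod_eq_of_lt (hjl.trans_lt hlen)] using hj⟩

/-! ### Periodic survival probabilities -/

@[to_additive]
theorem prod_range_add_of_periodic {M : Type*} [CommMonoid M] {f : ℕ → M} {L : ℕ}
    (hf : Function.Periodic f L) (a : ℕ) :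
    ∏ j ∈ Finset.range L, f (a + j) = ∏ j ∈ Finset.range L, f j := by
  calc ∏ j ∈ Finset.range L, f (a + j) = ∏ j ∈ Finset.Ico a (a + L), f (j % L) := by
        rw [Finset.prod_Ico_eq_prod_range, Nat.add_sub_cancel_left]
        exact Finset.prod_congr rfl fun j _ => (hf.map_mod_nat _).symm
    _ = ∏ j ∈ Finset.range L, f j := by
        rw [← Nat.image_Ico_mod a L, Finset.prod_image (Nat.mod_injOn_Ico a L)]

/-- The probability of surviving `s` rounds from round `θ` on, if round `j` is survived with
probability `a j` independently of the other rounds. -/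
noncomputable def survival (a : ℕ → ℝ) (θ s : ℕ) : ℝ := ∏ j ∈ Finset.range s, a (θ + j)

section Survival

variable {a : ℕ → ℝ} {L : ℕ}

theorem survival_add (a : ℕ → ℝ) (θ r s : ℕ) :
    survival a θ (r + s) = survival a θ r * survival a (θ + r) s := by
  simp [survival, Finset.prod_range_add, add_assoc]

theorem survival_nonneg (h0 : ∀ j, 0 ≤ a j) (θ s : ℕ) : 0 ≤ survival a θ s :=
  Finset.prod_nonneg fun _ _ => h0 _

theorem survival_le_one (h0 : ∀ j, 0 ≤ a j) (h1 : ∀ j, a j ≤ 1) (θ s : ℕ) :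
    survival a θ s ≤ 1 :=
  Finset.prod_le_one (fun _ _ => h0 _) fun _ _ => h1 _

theorem periodic_survival (ha : Function.Periodic a L) (s : ℕ) :
    Function.Periodic (fun θ => survival a θ s) L := fun θ => by
  simp only [survival, add_right_comm θ L]
  exact Finset.prod_congr rfl fun j _ => ha _

theorem survival_period (ha : Function.Periodic a L) (θ : ℕ) :
    survival a θ L = survival a 0 L := by
  simp only [survival, zero_add]
  exact prod_range_add_of_periodic ha θ

/-- After a full period the process starts afresh, with the survival probability `q` of one period
as a factor; hence the expected time is at most `1 / (1 - q)` times that spent in one period. -/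
theorem sum_survival_mul_le (ha : Function.Periodic a L) (h0 : ∀ j, 0 ≤ a j) (θ N : ℕ) :
    (∑ s ∈ Finset.range N, survival a θ s) * (1 - survival a 0 L) ≤
      ∑ s ∈ Finset.range L, survival a θ s := by
  have hrec : ∑ s ∈ Finset.range (L + N), survival a θ s =
      ∑ s ∈ Finset.range L, survival a θ s +
        survival a 0 L * ∑ s ∈ Finset.range N, survival a θ s := by
    rw [Finset.sum_range_add, Finset.mul_sum]
    congr 1
    refine Finset.sum_congr rfl fun s _ => ?_
    rw [survival_add, survival_period ha]
    exact congrArg _ (periodic_survival ha s θ)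
  have hmono : ∑ s ∈ Finset.range N, survival a θ s ≤ ∑ s ∈ Finset.range (L + N), survival a θ s :=
    Finset.sum_le_sum_of_subset_of_nonneg (Finset.range_mono (by omega))
      fun _ _ _ => survival_nonneg h0 _ _
  linarith

/-- The survival probabilities `x` over `r` rounds and `y` over the remaining `L - r` rounds of a
period have product `q`, so that `x + y ≤ 1 + q`. Averaged over the starting round, every `r` may be
paired with `L - r`. -/
theorem sum_survival_add_le (ha : Function.Periodic a L) (h0 : ∀ j, 0 ≤ a j) (h1 : ∀ j, a j ≤ 1)
    {r : ℕ} (hr : r ≤ L) :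
    ∑ θ ∈ Finset.range L, survival a θ r + ∑ θ ∈ Finset.range L, survival a θ (L - r) ≤
      L * (1 + survival a 0 L) := by
  rw [← sum_range_add_of_periodic (periodic_survival ha (L - r)) r, ← Finset.sum_add_distrib]
  refine (Finset.sum_le_card_nsmul _ _ (1 + survival a 0 L) fun θ _ => ?_).trans_eq (by simp [mul_add])
  have hmul : survival a θ r * survival a (r + θ) (L - r) = survival a 0 L := by
    rw [add_comm r θ, ← survival_add, Nat.add_sub_cancel' hr, survival_period ha]
  nlinarith [mul_nonneg (sub_nonneg.2 (survival_le_one h0 h1 θ r))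
    (sub_nonneg.2 (survival_le_one h0 h1 (r + θ) (L - r)))]

theorem two_mul_sum_sum_survival_le (ha : Function.Periodic a L) (h0 : ∀ j, 0 ≤ a j)
    (h1 : ∀ j, a j ≤ 1) :
    2 * ∑ θ ∈ Finset.range L, ∑ s ∈ Finset.range L, survival a θ s ≤
      L * (L * (1 + survival a 0 L) + (1 - survival a 0 L)) := by
  rw [Finset.sum_comm]
  set F : ℕ → ℝ := fun s => ∑ θ ∈ Finset.range L, survival a θ s
  have hFL : F L = L * survival a 0 L := by simp [F, survival_period ha]
  have hrefl : ∑ s ∈ Finset.range (L + 1), F (L - s) = ∑ s ∈ Finset.range (L + 1), F s := by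
    rw [← Finset.sum_range_reflect F (L + 1)]
    exact Finset.sum_congr rfl fun s _ => by congr 1
  have hpair : ∑ s ∈ Finset.range (L + 1), (F s + F (L - s)) ≤
      (L + 1) * (L * (1 + survival a 0 L)) := by
    refine (Finset.sum_le_card_nsmul _ _ (L * (1 + survival a 0 L)) fun s hs => ?_).trans_eq
      (by simp)
    exact sum_survival_add_le ha h0 h1 (by simpa [Nat.lt_succ_iff] using hs)
  rw [Finset.sum_add_distrib, hrefl, Finset.sum_range_succ, hFL] at hpair
  linarith

/-- `13 / 29` is the solution `q` of `(1 + q) / (2 * (1 - q)) = 21 / 16`. -/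
theorem sum_sum_survival_le (ha : Function.Periodic a L) (h0 : ∀ j, 0 ≤ a j)
    (h1 : ∀ j, a j ≤ 1) (hq : survival a 0 L ≤ 13 / 29) :
    ∑ θ ∈ Finset.range L, ∑ s ∈ Finset.range L, survival a θ s ≤
      L * (21 / 16 * L + 1 / 2) * (1 - survival a 0 L) := by
  have h := two_mul_sum_sum_survival_le ha h0 h1
  have hL : (0 : ℝ) ≤ (L : ℝ) * L := by positivity
  nlinarith [mul_nonneg hL (sub_nonneg.2 hq)]

/-- The hazards `1 - a j` of a period add up to at least `1`, so `q ≤ exp (-1)`. -/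
theorem survival_le_of_one_le_sum (h0 : ∀ j, 0 ≤ a j)
    (hsum : 1 ≤ ∑ j ∈ Finset.range L, (1 - a j)) : survival a 0 L ≤ 13 / 29 := by
  have h : survival a 0 L ≤ Real.exp (-1) :=
    calc survival a 0 L ≤ ∏ j ∈ Finset.range L, Real.exp (a j - 1) := by
          simp only [survival, zero_add]
          exact Finset.prod_le_prod (fun j _ => h0 j)
            fun j _ => by linarith [Real.add_one_le_exp (a j - 1)]
      _ = Real.exp (-∑ j ∈ Finset.range L, (1 - a j)) := by
          rw [← Real.exp_sum, ← Finset.sum_neg_distrib]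
          simp only [neg_sub]
      _ ≤ Real.exp (-1) := Real.exp_le_exp.2 (by linarith)
  have := Real.exp_neg_one_lt_d9
  norm_num at this ⊢
  linarith

theorem tsum_ofReal_survival_le (ha : Function.Periodic a L) (h0 : ∀ j, 0 ≤ a j)
    (hq : survival a 0 L < 1) (θ : ℕ) :
    ∑' s, ENNReal.ofReal (survival a θ s) ≤
      ENNReal.ofReal ((∑ s ∈ Finset.range L, survival a θ s) / (1 - survival a 0 L)) := by
  refine ENNReal.tsum_le_of_sum_range_le fun N => ?_
  rw [← ENNReal.ofReal_sum_of_nonneg fun s _ => survival_nonneg h0 θ s]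
  refine ENNReal.ofReal_le_ofReal ?_
  rw [le_div_iff₀ (sub_pos.2 hq)]
  exact sum_survival_mul_le ha h0 θ N

end Survival

/-! ### The capture time of a fixed plan -/

section CaptureTime

variable {V : Type u} {k : ℕ}

/-- A capture time `T` is the number of `s` such that rounds `1, …, s` are survived. -/
theorem captureTime_le_tsum (c : ℕ → Fin k → V) (g : ℕ → V) :
    captureTime c g ≤ ∑' s : ℕ,
      (Set.pi (Finset.Ico 1 (s + 1) : Set ℕ) fun t => {v | ∀ i, c t i ≠ v}).indicator 1 g := by
  classical
  by_cases h : ∃ t, 1 ≤ t ∧ ∃ i, c t i = g t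
  · have hmin : ∀ s < Nat.find h, g ∈ Set.pi (Finset.Ico 1 (s + 1) : Set ℕ)
        fun t => {v | ∀ i, c t i ≠ v} := by
      intro s hs t ht i hi
      simp only [Finset.coe_Ico, Set.mem_Ico] at ht
      exact Nat.find_min h (m := t) (by omega) ⟨ht.1, i, hi⟩
    calc captureTime c g ≤ (Nat.find h : ℝ≥0∞) := iInf₂_le (Nat.find h) (Nat.find_spec h)
      _ = ∑ s ∈ Finset.range (Nat.find h), (Set.pi (Finset.Ico 1 (s + 1) : Set ℕ)
            fun t => {v | ∀ i, c t i ≠ v}).indicator 1 g := by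
          rw [Finset.sum_congr rfl fun s hs =>
            Set.indicator_of_mem (hmin s (Finset.mem_range.1 hs)) _]
          simp
      _ ≤ _ := ENNReal.sum_le_tsum _
  · have hmem : ∀ s : ℕ, g ∈ Set.pi (Finset.Ico 1 (s + 1) : Set ℕ)
        fun t => {v | ∀ i, c t i ≠ v} := by
      intro s t ht i hi
      simp only [Finset.coe_Ico, Set.mem_Ico] at ht
      exact h ⟨t, ht.1, i, hi⟩
    rw [tsum_congr fun s => Set.indicator_of_mem (hmem s) _]
    simp

variable [MeasurableSpace V] [DiscreteMeasurableSpace V]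

/-- If the path of the cops ignores the observation, the rounds are independent. -/
theorem lintegral_captureTime_le (p : PMF V) (c : ℕ → Fin k → V) :
    ∫⁻ g, captureTime c g ∂law p ≤
      ∑' s : ℕ, ∏ j ∈ Finset.range s, p.toMeasure {v | ∀ i, c (1 + j) i ≠ v} := by
  have hmeas : ∀ s : ℕ, MeasurableSet (Set.pi (Finset.Ico 1 (s + 1) : Set ℕ)
      fun t => {v | ∀ i, c t i ≠ v}) := fun s =>
    .pi (Finset.countable_toSet _) fun _ _ => .of_discrete
  refine (lintegral_mono (captureTime_le_tsum c)).trans ?_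
  rw [lintegral_tsum fun s => (measurable_one.indicator (hmeas s)).aemeasurable]
  refine ENNReal.tsum_le_tsum fun s => ?_
  rw [lintegral_indicator_one (hmeas s), law,
    Measure.infinitePi_pi _ fun _ _ => .of_discrete, Finset.prod_Ico_eq_prod_range,
    Nat.add_sub_cancel]

end CaptureTime

/-! ### Cops patrolling a periodic tour -/

section Patrol

variable {V : Type u} {k : ℕ}

/-- The plan in which the `k` cops walk along `W` at distance `L` from each other, the first one
starting at time `θ` of `W`; the observation is ignored. -/
def patrol (W : ℕ → V) (k L θ : ℕ) : Plan V k := fun _ t i => W (θ + t + i * L)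

theorem patrol_isLegal {G : SimpleGraph V} {W : ℕ → V}
    (hW : ∀ j, W (j + 1) = W j ∨ G.Adj (W j) (W (j + 1))) (k L θ : ℕ) (pl : Placement) :
    (patrol W k L θ).IsLegal G pl := by
  refine ⟨fun o t i => ?_, fun _ _ _ => rfl⟩
  have h := hW (θ + t + i * L)
  rwa [add_right_comm, add_assoc θ t 1] at h

/-- If `W` has period `k * L`, the cops visit during a time step all that `W` visits at the times in
its residue class modulo `L`. -/
theorem exists_patrol_eq {W : ℕ → V} {L : ℕ} (hk : 0 < k) (hL : 0 < L)
    (hper : Function.Periodic W (k * L)) {t j : ℕ} (hj : j ≡ t [MOD L]) :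
    ∃ i : Fin k, W (t + i * L) = W j := by
  have hle : t ≤ j + t * (k * L) :=
    (Nat.le_mul_of_pos_right t (Nat.mul_pos hk hL)).trans (Nat.le_add_left _ _)
  have hmod : t ≡ j + t * (k * L) [MOD L] := by
    have : j + t * (k * L) ≡ j [MOD L] := by
      simp [Nat.ModEq, ← mul_assoc]
    exact (this.trans hj).symm
  obtain ⟨m, hm⟩ := (Nat.modEq_iff_dvd' hle).1 hmod
  refine ⟨⟨m % k, Nat.mod_lt _ hk⟩, ?_⟩
  have h₁ : t + m % k * L + m / k * (k * L) = j + t * (k * L) := by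
    have h₂ : m % k * L + m / k * (k * L) = L * m := by
      conv_rhs => rw [← Nat.mod_add_div m k]
      ring
    omega
  have h₃ := hper.nat_mul (m / k) (t + m % k * L)
  have h₄ := hper.nat_mul t j
  simp only [Nat.cast_id] at h₃ h₄
  rw [h₁, h₄] at h₃
  exact h₃.symm

variable [MeasurableSpace V]

/-- The probability that the gambler avoids every vertex that `W` visits at times congruent to `t`
modulo `L`. -/
noncomputable def avoidProb (p : PMF V) (W : ℕ → V) (L t : ℕ) : ℝ :=
  p.toMeasure.real {v | ∀ j, j ≡ t [MOD L] → W j ≠ v}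

theorem avoidProb_nonneg (p : PMF V) (W : ℕ → V) (L t : ℕ) : 0 ≤ avoidProb p W L t :=
  measureReal_nonneg

theorem avoidProb_le_one (p : PMF V) (W : ℕ → V) (L t : ℕ) : avoidProb p W L t ≤ 1 :=
  measureReal_le_one

theorem periodic_avoidProb (p : PMF V) (W : ℕ → V) (L : ℕ) :
    Function.Periodic (avoidProb p W L) L := fun t => by
  simp [avoidProb, Nat.ModEq]

variable [DiscreteMeasurableSpace V]

/-- Every vertex is visited by some cop in every period. -/
theorem survival_avoidProb_le (p : PMF V) {W : ℕ → V} (hW : Function.Surjective W) {L : ℕ}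
    (hL : 0 < L) : survival (avoidProb p W L) 0 L ≤ 13 / 29 := by
  refine survival_le_of_one_le_sum (avoidProb_nonneg p W L) ?_
  have hcover : ⋃ t ∈ Finset.range L, {v | ∀ j, j ≡ t [MOD L] → W j ≠ v}ᶜ = Set.univ := by
    refine Set.eq_univ_of_forall fun v => ?_
    obtain ⟨j, rfl⟩ := hW v
    simp only [Set.mem_iUnion, Finset.mem_range]
    exact ⟨j % L, Nat.mod_lt _ hL, fun h => h j (Nat.mod_modEq j L).symm rfl⟩
  calc (1 : ℝ) = p.toMeasure.real (⋃ t ∈ Finset.range L, {v | ∀ j, j ≡ t [MOD L] → W j ≠ v}ᶜ) := by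
        rw [hcover, probReal_univ]
    _ ≤ ∑ t ∈ Finset.range L, p.toMeasure.real {v | ∀ j, j ≡ t [MOD L] → W j ≠ v}ᶜ :=
        measureReal_biUnion_finset_le _ _
    _ = ∑ t ∈ Finset.range L, (1 - avoidProb p W L t) :=
        Finset.sum_congr rfl fun t _ => probReal_compl_eq_one_sub .of_discrete

theorem lintegral_captureTime_patrol_le (p : PMF V) {W : ℕ → V} {L : ℕ} (hk : 0 < k) (hL : 0 < L)
    (hper : Function.Periodic W (k * L)) (θ : ℕ) :
    ∫⁻ g, captureTime (patrol W k L θ (g 0)) g ∂law p ≤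
      ∑' s, ENNReal.ofReal (survival (avoidProb p W L) (1 + θ) s) := by
  refine (lintegral_captureTime_le p fun t (i : Fin k) => W (θ + t + i * L)).trans ?_
  refine ENNReal.tsum_le_tsum fun s => ?_
  rw [survival, ENNReal.ofReal_prod_of_nonneg fun j _ => avoidProb_nonneg p W L _]
  refine Finset.prod_le_prod' fun j _ => ?_
  rw [avoidProb, ofReal_measureReal]
  refine measure_mono fun v hv j' hj' hv' => ?_
  obtain ⟨i, hi⟩ := exists_patrol_eq hk hL hper hj'
  refine hv i ?_
  rw [← hv', ← hi]
  congr 2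
  ring

/-- The patrol with a uniformly random start `θ < L`. -/
noncomputable def randomPatrol (W : ℕ → V) (k L : ℕ) : Measure (Plan V k) :=
  (L : ℝ≥0∞)⁻¹ • ∑ θ ∈ Finset.range L, Measure.dirac (patrol W k L θ)


variable [Countable V]

theorem isStrategy_randomPatrol {G : SimpleGraph V} {W : ℕ → V}
    (hW : ∀ j, W (j + 1) = W j ∨ G.Adj (W j) (W (j + 1))) (k : ℕ) {L : ℕ} (hL : 0 < L)
    (pl : Placement) : IsStrategy G pl (randomPatrol W k L) := by
  refine ⟨⟨?_⟩, ?_⟩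
  · simp [randomPatrol, ENNReal.inv_mul_cancel, hL.ne']
  · refine Measure.ae_smul_measure ?_ _
    rw [ae_iff]
    simp [patrol_isLegal hW]

theorem expectedTime_randomPatrol_le (p : PMF V) {W : ℕ → V} (hW : Function.Surjective W) {L : ℕ}
    (hk : 0 < k) (hL : 0 < L) (hper : Function.Periodic W (k * L)) :
    expectedTime (randomPatrol W k L) p ≤ ENNReal.ofReal (21 / 16 * L + 1 / 2) := by
  have ha := periodic_avoidProb p W L
  have h0 := avoidProb_nonneg p W L
  have hq := survival_avoidProb_le p hW hL
  have hq' : 0 < 1 - survival (avoidProb p W L) 0 L := by linarith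
  have hLr : (0 : ℝ) < L := by exact_mod_cast hL
  have hsum : ∑ θ ∈ Finset.range L, ∫⁻ g, captureTime (patrol W k L θ (g 0)) g ∂law p ≤
      ENNReal.ofReal (L * (21 / 16 * L + 1 / 2)) := by
    refine (Finset.sum_le_sum fun θ _ => (lintegral_captureTime_patrol_le p hk hL hper θ).trans
      (tsum_ofReal_survival_le ha h0 (sub_pos.1 hq') (1 + θ))).trans ?_
    rw [← ENNReal.ofReal_sum_of_nonneg fun θ _ => div_nonneg
      (Finset.sum_nonneg fun s _ => survival_nonneg h0 _ s) hq'.le, ← Finset.sum_div]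
    refine ENNReal.ofReal_le_ofReal ?_
    rw [div_le_iff₀ hq']
    have hper' : Function.Periodic
        (fun θ => ∑ s ∈ Finset.range L, survival (avoidProb p W L) θ s) L := fun θ =>
      Finset.sum_congr rfl fun s _ => periodic_survival ha s θ
    rw [sum_range_add_of_periodic hper' 1]
    exact sum_sum_survival_le ha h0 (avoidProb_le_one p W L) hq
  rw [expectedTime, randomPatrol, lintegral_smul_measure, lintegral_finsetSum_measure]
  simp only [lintegral_dirac, smul_eq_mul]
  refine (mul_le_mul_right hsum _).trans_eq ?_
  rw [ENNReal.ofReal_mul hLr.le, ENNReal.ofReal_natCast, ← mul_assoc,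
    ENNReal.inv_mul_cancel (by simpa using hL.ne') (by simp), one_mul]

end Patrol

/-- The period `L = 2 n / k + 1` is such that the cyclic tour has length `k * L ≥ 2 n`. -/
theorem ect₁_le {V : Type u} [Fintype V] {G : SimpleGraph V} (hG : G.Connected) (pl : Placement)
    {k : ℕ} (hk : 0 < k) :
    ect₁ G pl k ≤ ENNReal.ofReal (21 / 8 * (Fintype.card V / k) + 29 / 16) := by
  let _ : MeasurableSpace V := ⊤
  set L := 2 * Fintype.card V / k + 1 with hLdef
  have hL : 0 < L := Nat.succ_pos _
  have hM : 2 * Fintype.card V ≤ k * L := (Nat.lt_mul_div_succ _ hk).le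
  obtain ⟨W, hstep, hper, hsurj⟩ := exists_periodic_tour hG hM
  refine (iInf₂_le (randomPatrol W k L) (isStrategy_randomPatrol hstep k hL pl)).trans ?_
  refine iSup_le fun p => (expectedTime_randomPatrol_le p hsurj hk hL hper).trans ?_
  refine ENNReal.ofReal_le_ofReal ?_
  have hdiv : ((2 * Fintype.card V / k : ℕ) : ℝ) ≤ 2 * Fintype.card V / k := by
    simpa using Nat.cast_div_le (α := ℝ) (m := 2 * Fintype.card V) (n := k)
  rw [hLdef]
  push_cast
  rw [mul_div_assoc] at hdiv
  linarith

end Gambler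

theorem theorem3p6 :
    ∃ C : ℝ, ∀ (V : Type u) [Fintype V] (G : SimpleGraph V), G.Connected →
      ∀ pl : Gambler.Placement,
        Gambler.th₁ G pl ≤ ENNReal.ofReal (√42 / 2 * √(Fintype.card V : ℝ) + C) := by
  refine ⟨3, fun V _ G hG pl => ?_⟩
  have hcard : 0 < Fintype.card V := Fintype.card_pos_iff.2 hG.nonempty
  set n : ℝ := (Fintype.card V : ℝ)
  have hnpos : 0 < n := Nat.cast_pos.2 hcard
  -- `x` minimizes `x + 21 / 8 * (n / x)`, where both terms are equal.
  set x : ℝ := √42 / 4 * √n with hx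
  have hxpos : 0 < x := by positivity
  have hxx : 21 / 8 * (n / x) = x := by
    have : x * x = 21 / 8 * n := by
      rw [hx, mul_mul_mul_comm, div_mul_div_comm, Real.mul_self_sqrt (by norm_num),
        Real.mul_self_sqrt hnpos.le]
      norm_num
    field_simp
    linarith
  set k : ℕ := ⌈x⌉₊
  have hk : 0 < k := Nat.ceil_pos.2 hxpos
  have hxk : x ≤ k := Nat.le_ceil x
  have hkx : (k : ℝ) < x + 1 := Nat.ceil_lt_add_one hxpos.le
  have hdiv : n / k ≤ n / x := div_le_div_of_nonneg_left hnpos.le hxpos hxk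
  calc Gambler.th₁ G pl ≤ k + Gambler.ect₁ G pl k := iInf₂_le k hk
    _ ≤ ENNReal.ofReal k + ENNReal.ofReal (21 / 8 * (n / k) + 29 / 16) := by
        rw [ENNReal.ofReal_natCast]
        gcongr
        exact Gambler.ect₁_le hG pl hk
    _ = ENNReal.ofReal (k + (21 / 8 * (n / k) + 29 / 16)) :=
        (ENNReal.ofReal_add (by positivity) (by positivity)).symm
    _ ≤ ENNReal.ofReal (√42 / 2 * √n + 3) := by
        refine ENNReal.ofReal_le_ofReal ?_
        have : √42 / 2 * √n = 2 * x := by rw [hx]; ring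
        linarith
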